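/- Let $p_0,p_1$ be probability densities on a finite set $\mathcal X$, identified with the diagonal matrices $\sum_{x}p_\theta(x)|e_x\rangle\langle e_x|$, and let $\sigma_0,\sigma_1$ be density operators on a finite dimensional complex Hilbert space $\mathcal H$. For a convex function $f:[0,\infty)\to(-\infty,\infty]$ that is finite on $(0,\infty)$ put $$D_f(p_0\|p_1):=\sum_{x:\,p_1(x)\neq 0}p_1(x)\,f\!\left(\frac{p_0(x)}{p_1(x)}\right)+\Big(\sum_{x:\,p_1(x)=0}p_0(x)\Big)\lim_{\lambda\to\infty}\frac{f(\lambda)}{\lambda}\in(-\infty,\infty]$$ (with $0\cdot\infty=0$), and let $D_f^{\max}(\sigma_0\|\sigma_1)$ be the infimum of $D_f(q_0\|q_1)$ over all pairs of probability densities $q_0,q_1$ on finite sets for which there is a completely positive trace preserving (CPTP) map $\Gamma$ with $\Gamma(q_\theta)=\sigma_\theta$, $\theta=0,1$. (a) If $D_f(p_0\|p_1)=D_f^{\max}(\sigma_0\|\sigma_1)$ for every continuous operator convex function $f:[0,\infty)\to\mathbb R$, then there is a CPTP map $\Gamma$ with $\Gamma(p_\theta)=\sigma_\theta$ for $\theta=0,1$.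 (b) In fact, let $s_0\in(0,1)$ be arbitrary. If the identity $D_f(p_0\|p_1)=D_f^{\max}(\sigma_0\|\sigma_1)$ holds for $f(\lambda)=(t+\lambda)^{-1}$ for all $t\ge 0$ (where for $t=0$ the value at $\lambda=0$ is $+\infty$), and for $f(\lambda)=-\lambda^s$ for all $s\in(s_0,1)$, then there is a CPTP map $\Gamma$ with $\Gamma(p_\theta)=\sigma_\theta$ for $\theta=0,1$. -/

import Mathlib

open scoped ComplexOrder MatrixOrder Matrix.Norms.L2Operator

noncomputable section

/-- The slope at infinity `lim_{x → ∞} f x / x`. For a convex `f` the limit exists in the extended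
reals, and the limit superior is then this limit. -/
def slopeAtTop (f : ℝ → EReal) : EReal :=
  Filter.limsup (fun x : ℝ => f x / (x : EReal)) Filter.atTop

/-- The classical `f`-divergence `D_f(p₀ ‖ p₁)` of two probability densities on a finite set, for an
extended real valued `f` on `[0, ∞)`, with the convention `0 · (±∞) = 0`. -/
def fDivergence {X : Type*} [Fintype X] (f : ℝ → EReal) (p₀ p₁ : X → ℝ) : EReal :=
  (∑ x with p₁ x ≠ 0, (p₁ x : EReal) * f (p₀ x / p₁ x)) +
    ((∑ x with p₁ x = 0, p₀ x : ℝ) : EReal) * slopeAtTop f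

/-- Density operators (quantum states). -/
def IsDensityMatrix {n : Type*} [Fintype n] (σ : Matrix n n ℂ) : Prop :=
  σ.PosSemidef ∧ σ.trace = 1

/-- A density `p` on `X`, regarded as the diagonal matrix `∑ x, p x |e_x⟩⟨e_x|`. -/
def densityToMatrix {X : Type*} [DecidableEq X] (p : X → ℝ) : Matrix X X ℂ :=
  Matrix.diagonal fun x => (p x : ℂ)

/-- There is a completely positive trace preserving map `Γ` with `Γ p₀ = σ₀` and `Γ p₁ = σ₁`. -/
def ExistsCPTP {X n : Type*} [Fintype X] [DecidableEq X] [Fintype n] [DecidableEq n]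
    (p₀ p₁ : X → ℝ) (σ₀ σ₁ : Matrix n n ℂ) : Prop :=
  ∃ Γ : CompletelyPositiveMap (Matrix X X ℂ) (Matrix n n ℂ),
    (∀ A : Matrix X X ℂ, (Γ A).trace = A.trace) ∧
      Γ (densityToMatrix p₀) = σ₀ ∧ Γ (densityToMatrix p₁) = σ₁

/-- The maximal quantum `f`-divergence: the infimum of the classical `f`-divergences of all pairs of
probability densities on finite sets that some CPTP map sends to `(σ₀, σ₁)`. -/
def maxFDivergence {n : Type*} [Fintype n] [DecidableEq n]
    (f : ℝ → EReal) (σ₀ σ₁ : Matrix n n ℂ) : EReal :=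
  sInf {d | ∃ (k : ℕ) (q₀ q₁ : Fin k → ℝ), q₀ ∈ stdSimplex ℝ (Fin k) ∧ q₁ ∈ stdSimplex ℝ (Fin k) ∧
    ExistsCPTP q₀ q₁ σ₀ σ₁ ∧ d = fDivergence f q₀ q₁}

/-- `f` is operator convex on `[0, ∞)`: for every size `m`, the map `A ↦ f(A)` given by the
functional calculus is convex, in the Loewner order, on the positive semidefinite matrices. -/
def OperatorConvex (f : ℝ → ℝ) : Prop :=
  ∀ m : ℕ, ConvexOn ℝ {A : Matrix (Fin m) (Fin m) ℂ | 0 ≤ A} (fun A => cfc f A)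

/-- The function `x ↦ (t + x)⁻¹` on `[0, ∞)`, for `t ≥ 0`, with the value `+∞` where `t + x = 0`
(that is, at `x = 0` if `t = 0`). -/
def invShift (t x : ℝ) : EReal :=
  if t + x = 0 then ⊤ else (((t + x)⁻¹ : ℝ) : EReal)

/-- The function `x ↦ -x ^ s` on `[0, ∞)`. -/
def negPow (s x : ℝ) : EReal := ((-(x ^ s) : ℝ) : EReal)

end

/-! Two positive semidefinite matrices are simultaneously diagonal by congruence:
`σ₀ = V (1 - c) Vᴴ` and `σ₁ = V c Vᴴ` with a real diagonal matrix `0 ≤ c ≤ 1`. Mixing the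
normalized rank one matrices `v vᴴ`, for `v` a column of `V`, gives a pair of densities `(q₀, q₁)`
and a preparation of `(σ₀, σ₁)` from it. With `S` solving `(σ₀ + t σ₁) S = σ₁`, the
Cauchy–Schwarz inequality bounds `D_f` of every pair that prepares `(σ₀, σ₁)` from below by
`tr (σ₁ S)` when `f x = (t + x)⁻¹`, and `(q₀, q₁)` attains this bound for all `t > 0` at once.
Hence the hypothesis says that `(p₀, p₁)` and `(q₀, q₁)` have the same `f`-divergences for these
`f`. The functions `t ↦ (t + y)⁻¹` being linearly independent for distinct `y`, these
divergences determine the law of the likelihood `p₁ / (p₀ + p₁)`, which is a sufficient statistic: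
whatever can be prepared from `(q₀, q₁)` can be prepared from `(p₀, p₁)`. -/

open Matrix

section DiagonalCongruence

variable {m n 𝕜 : Type*} [Fintype m] [DecidableEq m] [RCLike 𝕜]

/-- The matrix `V * diagonal d * Vᴴ` congruent to the real diagonal matrix of `d`, as a linear
function of `d`. -/
def diagonalCongruence (V : Matrix n m 𝕜) : (m → ℝ) →ₗ[ℝ] Matrix n n 𝕜 where
  toFun d := V * diagonal (fun j => (d j : 𝕜)) * Vᴴ
  map_add' d e := by
    simp only [Pi.add_apply, RCLike.ofReal_add, ← diagonal_add, Matrix.mul_add, Matrix.add_mul]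
  map_smul' r d := by
    have h : diagonal (fun j => (((r • d) j : ℝ) : 𝕜)) = r • diagonal fun j => (d j : 𝕜) := by
      rw [← diagonal_smul]
      congr 1
      ext j
      simp only [Pi.smul_apply, smul_eq_mul, RCLike.ofReal_mul, RCLike.real_smul_eq_coe_mul]
    rw [h, Matrix.mul_smul, Matrix.smul_mul, RingHom.id_apply]

lemma diagonalCongruence_apply (V : Matrix n m 𝕜) (d : m → ℝ) :
    diagonalCongruence V d = V * diagonal (fun j => (d j : 𝕜)) * Vᴴ := rfl

lemma diagonalCongruence_one (V : Matrix n m 𝕜) : diagonalCongruence V 1 = V * Vᴴ := by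
  simp only [diagonalCongruence_apply, Pi.one_apply, RCLike.ofReal_one, diagonal_one,
    Matrix.mul_one]

lemma diagonalCongruence_nonneg [Finite n] (V : Matrix n m 𝕜) {d : m → ℝ} (hd : 0 ≤ d) :
    0 ≤ diagonalCongruence V d := by
  refine nonneg_iff_posSemidef.mpr (PosSemidef.mul_mul_conjTranspose_same ?_ V)
  exact posSemidef_diagonal_iff.mpr fun j => RCLike.ofReal_nonneg.mpr (hd j)

lemma diagonalCongruence_eq_sum (V : Matrix n m 𝕜) (d : m → ℝ) :
    diagonalCongruence V d = ∑ j, d j • diagonalCongruence V (Pi.single j 1) := by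
  conv_lhs => rw [pi_eq_sum_univ' d, map_sum]
  simp only [map_smul]

lemma exists_forall_diagonalCongruence_mul [Fintype n] {V W : Matrix n m 𝕜} {c : m → ℝ}
    (hVW : Vᴴ * W * diagonal (fun j => (c j : 𝕜)) = diagonal fun j => (c j : 𝕜)) (g : m → ℝ) :
    ∃ S : Matrix n n 𝕜, ∀ a : m → ℝ,
      diagonalCongruence V a * S = diagonalCongruence V (a * (c * g)) := by
  have hdiag (d e : m → ℝ) : diagonal (fun j => ((d * e) j : 𝕜)) =
      diagonal (fun j => (d j : 𝕜)) * diagonal (fun j => (e j : 𝕜)) := by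
    simp only [diagonal_mul_diagonal, Pi.mul_apply, RCLike.ofReal_mul]
  refine ⟨W * diagonal (fun j => ((c * g) j : 𝕜)) * Vᴴ, fun a => ?_⟩
  calc _ = V * diagonal (fun j => (a j : 𝕜)) *
        (Vᴴ * W * diagonal (fun j => (c j : 𝕜)) * diagonal (fun j => (g j : 𝕜))) * Vᴴ := by
        simp only [diagonalCongruence_apply, hdiag, Matrix.mul_assoc]
    _ = diagonalCongruence V (a * (c * g)) := by
      simp only [hVW, diagonalCongruence_apply, hdiag, Matrix.mul_assoc]

end DiagonalCongruence

section SimultaneousDiagonalization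

variable {n 𝕜 : Type*} [Fintype n] [RCLike 𝕜] {A B : Matrix n n 𝕜}

lemma mul_eq_zero_of_nonneg_of_le {C : Matrix n n 𝕜} (hB : 0 ≤ B) (hBA : B ≤ A)
    (hAC : A * C = 0) : B * C = 0 := by
  classical
  have hCBC : star C * B * C = 0 := by
    refine le_antisymm ?_ (star_left_conjugate_nonneg hB C)
    simpa [mul_assoc, hAC] using star_left_conjugate_le_conjugate hBA C
  obtain ⟨D, rfl⟩ := CStarAlgebra.nonneg_iff_eq_star_mul_self.mp hB
  have hDC : D * C = 0 := by
    rw [← conjTranspose_mul_self_eq_zero, conjTranspose_mul, ← hCBC]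
    simp only [star_eq_conjTranspose, mul_assoc]
  rw [mul_assoc, hDC, mul_zero]

lemma exists_sqrt_pseudoinverse (hA : 0 ≤ A) :
    ∃ R Q : Matrix n n 𝕜, IsSelfAdjoint R ∧ IsSelfAdjoint Q ∧ R * R = A ∧ R * Q = Q * R ∧
      R * Q * R = R ∧ Q * R * Q = Q := by
  classical
  have hcont (f : ℝ → ℝ) : ContinuousOn f (spectrum ℝ A) := A.finite_real_spectrum.continuousOn f
  have hmul (f g : ℝ → ℝ) : cfc f A * cfc g A = cfc (fun x => f x * g x) A :=
    (cfc_mul f g A (hcont f) (hcont g)).symm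
  refine ⟨cfc Real.sqrt A, cfc (fun x => (√x)⁻¹) A, cfc_predicate _ A, cfc_predicate _ A,
    ?_, ?_, ?_, ?_⟩
  · rw [hmul]
    refine (cfc_congr fun x hx => ?_).trans (cfc_id ℝ A)
    exact Real.mul_self_sqrt (spectrum_nonneg_of_nonneg hA hx)
  · simp only [hmul, mul_comm]
  · simp only [hmul, mul_inv_mul_cancel]
  · rw [hmul, hmul]
    refine cfc_congr fun x _ => ?_
    simpa only [inv_inv] using mul_inv_mul_cancel (√x)⁻¹

variable [DecidableEq n]

lemma exists_contraction_factorization (hB : 0 ≤ B) (hBA : B ≤ A) :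
    ∃ R Q T : Matrix n n 𝕜, IsSelfAdjoint R ∧ R * R = A ∧ 0 ≤ T ∧ T ≤ 1 ∧
      R * T * R = B ∧ R * Q * T = T := by
  obtain ⟨R, Q, hR, hQ, rfl, hcomm, hRQR, hQRQ⟩ := exists_sqrt_pseudoinverse (hB.trans hBA)
  have hP : IsSelfAdjoint (R * Q) := (hR.commute_iff hQ).mp hcomm
  have hPP : R * Q * (R * Q) = R * Q := by rw [← mul_assoc, hRQR]
  have hBP : B * (R * Q) = B := by
    have h : R * R * (1 - R * Q) = 0 := by
      rw [mul_sub, mul_one, sub_eq_zero, hcomm, mul_assoc, ← mul_assoc R Q R, hRQR]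
    have := mul_eq_zero_of_nonneg_of_le hB hBA h
    rw [mul_sub, mul_one, sub_eq_zero] at this
    exact this.symm
  have hPB : R * Q * B = B := by
    simpa only [star_mul, hP.star_eq, (IsSelfAdjoint.of_nonneg hB).star_eq] using congrArg star hBP
  refine ⟨R, Q, Q * B * Q, hR, rfl, hQ.conjugate_nonneg hB, ?_, ?_, ?_⟩
  · calc Q * B * Q ≤ Q * (R * R) * Q := hQ.conjugate_le_conjugate hBA
      _ = R * Q := by rw [← mul_assoc, ← hcomm, mul_assoc, hPP]
      _ ≤ 1 := by
        rw [← sub_nonneg]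
        convert star_mul_self_nonneg (1 - R * Q) using 1
        rw [star_sub, star_one, hP.star_eq, sub_mul, one_mul, mul_sub, mul_one, hPP, sub_self,
          sub_zero]
  · calc R * (Q * B * Q) * R = R * Q * B * (Q * R) := by simp only [mul_assoc]
      _ = B := by rw [hPB, ← hcomm, hBP]
  · simp only [← mul_assoc, hcomm, hQRQ]

lemma exists_unitary_diagonal_of_nonneg_of_le_one {T : Matrix n n 𝕜} (hT₀ : 0 ≤ T)
    (hT₁ : T ≤ 1) :
    ∃ U ∈ unitaryGroup n 𝕜, ∃ c : n → ℝ, (∀ j, c j ∈ Set.Icc 0 1) ∧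
      T = U * diagonal (fun j => (c j : 𝕜)) * Uᴴ := by
  have hT := nonneg_iff_posSemidef.mp hT₀
  refine ⟨hT.1.eigenvectorUnitary, hT.1.eigenvectorUnitary.2, hT.1.eigenvalues, fun j => ⟨?_, ?_⟩,
    ?_⟩
  · exact hT.eigenvalues_nonneg j
  · exact (CFC.le_one_iff T).mp hT₁ _ (hT.1.eigenvalues_mem_spectrum_real j)
  · conv_lhs => rw [hT.1.spectral_theorem, Unitary.conjStarAlgAut_apply]
    rfl

lemma exists_simultaneous_diagonalization {σ₀ σ₁ : Matrix n n 𝕜} (h₀ : 0 ≤ σ₀) (h₁ : 0 ≤ σ₁) :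
    ∃ (V W : Matrix n n 𝕜) (c : n → ℝ), (∀ j, c j ∈ Set.Icc 0 1) ∧
      diagonalCongruence V (1 - c) = σ₀ ∧ diagonalCongruence V c = σ₁ ∧
      Vᴴ * W * diagonal (fun j => (c j : 𝕜)) = diagonal fun j => (c j : 𝕜) := by
  obtain ⟨R, Q, T, hR, hRR, hT₀, hT₁, hRTR, hRQT⟩ :=
    exists_contraction_factorization h₁ (le_add_of_nonneg_left h₀)
  obtain ⟨U, hU, c, hc, rfl⟩ := exists_unitary_diagonal_of_nonneg_of_le_one hT₀ hT₁
  have hUU : Uᴴ * U = 1 := mem_unitaryGroup_iff'.mp hU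
  have hUU' : U * Uᴴ = 1 := mem_unitaryGroup_iff.mp hU
  have hRH : Rᴴ = R := hR
  have hsum : diagonalCongruence (R * U) 1 = σ₀ + σ₁ := by
    rw [diagonalCongruence_one, conjTranspose_mul, hRH, mul_assoc, ← mul_assoc U, hUU', one_mul,
      hRR]
  have hσ₁ : diagonalCongruence (R * U) c = σ₁ := by
    rw [← hRTR, diagonalCongruence_apply, conjTranspose_mul, hRH]
    simp only [mul_assoc]
  refine ⟨R * U, Q * U, c, hc, ?_, hσ₁, ?_⟩
  · rw [map_sub, hsum, hσ₁, add_sub_cancel_right]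
  · have hRQUD : R * Q * (U * diagonal fun j => (c j : 𝕜)) = U * diagonal fun j => (c j : 𝕜) := by
      simpa only [mul_assoc, hUU, mul_one] using congrArg (· * U) hRQT
    rw [conjTranspose_mul, hRH, mul_assoc Uᴴ, ← mul_assoc R, mul_assoc, mul_assoc (R * Q), hRQUD,
      ← mul_assoc, hUU, one_mul]

end SimultaneousDiagonalization

section Preparation

-- On a `CStarMatrix` the instances that `CStarAlgebra.nonneg_iff_eq_star_mul_self` asks for are
-- only found by way of `NonUnitalCStarAlgebra`.
lemma exists_eq_star_mul_self_of_nonneg {A : Type*} [NonUnitalCStarAlgebra A] [PartialOrder A]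
    [StarOrderedRing A] {a : A} (ha : 0 ≤ a) : ∃ b : A, a = star b * b :=
  CStarAlgebra.nonneg_iff_eq_star_mul_self.mp ha

variable {X A : Type*} [Fintype X] [DecidableEq X] [NonUnitalCStarAlgebra A] [PartialOrder A]
  [StarOrderedRing A]

/-- The completely positive map that measures the basis `e` and prepares `τ x` on the outcome
`x`, i.e. `M ↦ ∑ x, ⟨e x, M (e x)⟩ • τ x`. -/
def measurePrepare (τ : X → A) (hτ : ∀ x, 0 ≤ τ x) : CompletelyPositiveMap (Matrix X X ℂ) A where
  toFun M := ∑ x, M x x • τ x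
  map_add' M N := by simp only [Matrix.add_apply, add_smul, Finset.sum_add_distrib]
  map_smul' r M := by
    simp only [Matrix.smul_apply, smul_eq_mul, mul_smul, Finset.smul_sum, RingHom.id_apply]
  map_cstarMatrix_nonneg' k M hM := by
    obtain ⟨N, rfl⟩ := exists_eq_star_mul_self_of_nonneg hM
    choose B hB using fun x => exists_eq_star_mul_self_of_nonneg (hτ x)
    -- With `τ x = star (B x) * B x` the image of `star N * N` is a sum of squares.
    let Q (x y : X) : CStarMatrix (Fin k) (Fin k) A :=
      CStarMatrix.ofMatrix (Matrix.of fun l j => N l j y x • B x)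
    suffices h : ∑ x, ∑ y, star (Q x y) * Q x y =
        (star N * N).map fun M => ∑ x, M x x • τ x by
      refine h ▸ Finset.sum_nonneg fun x _ => Finset.sum_nonneg fun y _ => star_mul_self_nonneg _
    have sum_apply (F : X → CStarMatrix (Fin k) (Fin k) A) (i j : Fin k) :
        (∑ x, F x) i j = ∑ x, F x i j := Matrix.sum_apply i j Finset.univ F
    ext1 i j
    rw [CStarMatrix.map_apply, sum_apply]
    refine Finset.sum_congr rfl fun x _ => ?_
    simp only [sum_apply, CStarMatrix.mul_apply, CStarMatrix.star_apply, Matrix.sum_apply,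
      Matrix.mul_apply, star_apply, Finset.sum_smul, hB x]
    rw [Finset.sum_comm]
    refine Finset.sum_congr rfl fun l _ => Finset.sum_congr rfl fun y _ => ?_
    exact (star_smul (N l i y x) (B x)).symm ▸ smul_mul_smul_comm _ _ _ _

lemma measurePrepare_apply (τ : X → A) (hτ : ∀ x, 0 ≤ τ x) (M : Matrix X X ℂ) :
    measurePrepare τ hτ M = ∑ x, M x x • τ x := rfl

lemma measurePrepare_densityToMatrix (τ : X → A) (hτ : ∀ x, 0 ≤ τ x) (p : X → ℝ) :
    measurePrepare τ hτ (densityToMatrix p) = ∑ x, p x • τ x := by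
  simp only [measurePrepare_apply, densityToMatrix, diagonal_apply_eq, Complex.coe_smul]

end Preparation

section DensityMatrix

variable {n : Type*} [Fintype n]

lemma IsDensityMatrix.exists_trace_smul_eq {ρ A : Matrix n n ℂ} (hρ : IsDensityMatrix ρ)
    (hA : A.PosSemidef) : ∃ τ, IsDensityMatrix τ ∧ A.trace.re • τ = A := by
  have htr : (A.trace.re : ℂ) = A.trace :=
    (Complex.eq_re_of_ofReal_le hA.trace_nonneg).symm
  by_cases h : A.trace = 0
  · exact ⟨ρ, hρ, by rw [h, Complex.zero_re, zero_smul, hA.trace_eq_zero_iff.mp h]⟩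
  · refine ⟨(A.trace)⁻¹ • A, ⟨hA.smul (inv_nonneg.mpr hA.trace_nonneg), ?_⟩, ?_⟩
    · rw [trace_smul, smul_eq_mul, inv_mul_cancel₀ h]
    · rw [← Complex.coe_smul, htr, smul_inv_smul₀ h]

lemma trace_sum_smul_of_isDensityMatrix {X : Type*} [Fintype X] {τ : X → Matrix n n ℂ}
    (hτ : ∀ x, IsDensityMatrix (τ x)) (p : X → ℝ) : (∑ x, p x • τ x).trace = (∑ x, p x : ℝ) := by
  simp only [trace_sum, trace_smul, (hτ _).2, Complex.real_smul, mul_one, Complex.ofReal_sum]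

lemma IsDensityMatrix.exists_mixture_diagonalCongruence {m : Type*} [Fintype m] [DecidableEq m]
    {ρ : Matrix n n ℂ} (hρ : IsDensityMatrix ρ) (V : Matrix n m ℂ) :
    ∃ (w : m → ℝ) (τ : m → Matrix n n ℂ), 0 ≤ w ∧ (∀ j, IsDensityMatrix (τ j)) ∧
      ∀ d : m → ℝ, ∑ j, (d j * w j) • τ j = diagonalCongruence V d := by
  have hpos (j : m) : (diagonalCongruence V (Pi.single j 1)).PosSemidef :=
    nonneg_iff_posSemidef.mp (diagonalCongruence_nonneg V (Pi.single_nonneg.mpr zero_le_one))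
  choose τ hτ htr using fun j => hρ.exists_trace_smul_eq (hpos j)
  refine ⟨_, τ, fun j => (Complex.nonneg_iff.mp (hpos j).trace_nonneg).1, hτ, fun d => ?_⟩
  simp only [mul_smul, htr, ← diagonalCongruence_eq_sum]

lemma re_trace_conjTranspose_mul {A : Matrix n n ℂ} (hA : A.IsHermitian) (S : Matrix n n ℂ) :
    (Sᴴ * A).trace.re = (A * S).trace.re := by
  rw [← Complex.conj_re (A * S).trace, ← Complex.star_def, ← trace_conjTranspose,
    conjTranspose_mul, hA.eq]

lemma IsDensityMatrix.sq_re_trace_mul_le {τ : Matrix n n ℂ} (hτ : IsDensityMatrix τ)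
    (S : Matrix n n ℂ) : (τ * S).trace.re ^ 2 ≤ (Sᴴ * τ * S).trace.re := by
  classical
  have hconj := re_trace_conjTranspose_mul hτ.1.1 S
  set r : ℝ := (τ * S).trace.re
  have hexp : (r • (1 : Matrix n n ℂ) - S)ᴴ * τ * (r • 1 - S) =
      (r ^ 2) • τ - r • (τ * S) - r • (Sᴴ * τ) + Sᴴ * τ * S := by
    simp only [conjTranspose_sub, conjTranspose_smul, conjTranspose_one, star_trivial, sub_mul,
      mul_sub, smul_mul_assoc, mul_smul_comm, one_mul, mul_one, smul_sub, smul_smul, ← pow_two]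
    abel
  have hnonneg := (Complex.nonneg_iff.mp (hexp ▸
    (hτ.1.conjTranspose_mul_mul_same (r • (1 : Matrix n n ℂ) - S)).trace_nonneg)).1
  simp only [trace_add, trace_sub, trace_smul, hτ.2, Complex.add_re, Complex.sub_re,
    Complex.smul_re, Complex.one_re, smul_eq_mul, hconj] at hnonneg
  linarith

end DensityMatrix

section Mixture

variable {X Y n : Type*} [Fintype X] [DecidableEq X] [Fintype Y] [DecidableEq Y] [Fintype n]
  [DecidableEq n] {p₀ p₁ : X → ℝ} {σ₀ σ₁ : Matrix n n ℂ}

lemma densityToMatrix_eq_sum_single (p : X → ℝ) :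
    densityToMatrix p = ∑ x, p x • single x x (1 : ℂ) := by
  simp only [densityToMatrix, ← sum_single_eq_diagonal, ← Complex.coe_smul, smul_single,
    smul_eq_mul, mul_one]

lemma existsCPTP_iff_exists_mixture :
    ExistsCPTP p₀ p₁ σ₀ σ₁ ↔ ∃ τ : X → Matrix n n ℂ, (∀ x, IsDensityMatrix (τ x)) ∧
      ∑ x, p₀ x • τ x = σ₀ ∧ ∑ x, p₁ x • τ x = σ₁ := by
  constructor
  · rintro ⟨Γ, htr, h₀, h₁⟩
    have hΓ (p : X → ℝ) : Γ (densityToMatrix p) = ∑ x, p x • Γ (single x x 1) := by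
      simp only [densityToMatrix_eq_sum_single, map_sum, ← Complex.coe_smul, map_smul]
    refine ⟨fun x => Γ (single x x 1), fun x => ⟨?_, ?_⟩, (hΓ p₀).symm.trans h₀,
      (hΓ p₁).symm.trans h₁⟩
    · rw [← nonneg_iff_posSemidef]
      refine map_nonneg Γ (nonneg_iff_posSemidef.mpr ?_)
      rw [← diagonal_single, posSemidef_diagonal_iff]
      exact Pi.single_nonneg.mpr zero_le_one
    · rw [htr, trace_single_eq_same]
  · rintro ⟨τ, hτ, h₀, h₁⟩
    refine ⟨measurePrepare τ fun x => nonneg_iff_posSemidef.mpr (hτ x).1, fun M => ?_, ?_, ?_⟩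
    · simp only [measurePrepare_apply, trace_sum, trace_smul, (hτ _).2, smul_eq_mul, mul_one]
      rfl
    · rw [measurePrepare_densityToMatrix, h₀]
    · rw [measurePrepare_densityToMatrix, h₁]

lemma ExistsCPTP.comp_equiv (h : ExistsCPTP p₀ p₁ σ₀ σ₁) (e : Y ≃ X) :
    ExistsCPTP (p₀ ∘ e) (p₁ ∘ e) σ₀ σ₁ := by
  obtain ⟨τ, hτ, rfl, rfl⟩ := existsCPTP_iff_exists_mixture.mp h
  exact existsCPTP_iff_exists_mixture.mpr ⟨τ ∘ e, fun y => hτ (e y),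
    e.sum_comp fun x => p₀ x • τ x, e.sum_comp fun x => p₁ x • τ x⟩

end Mixture

section InvDivergence

variable {X : Type*} [Fintype X]

/-- The `f`-divergence for `f x = (t + x)⁻¹`, as a real number (see `fDivergence_invShift`). -/
noncomputable def invDivergence (t : ℝ) (p₀ p₁ : X → ℝ) : ℝ :=
  ∑ x, p₁ x ^ 2 / (p₀ x + t * p₁ x)

lemma invDivergence_mul (t : ℝ) (c w : X → ℝ) :
    invDivergence t ((1 - c) * w) (c * w) =
      ∑ x, w x * (c x ^ 2 / (1 - c x + t * c x)) := by
  refine Finset.sum_congr rfl fun x _ => ?_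
  simp only [Pi.mul_apply, Pi.sub_apply, Pi.one_apply]
  rcases eq_or_ne (w x) 0 with h | h
  · simp only [h, mul_zero, zero_mul, zero_pow two_ne_zero, zero_div]
  · rw [← mul_assoc, ← add_mul, mul_pow, pow_two (w x), ← mul_assoc, mul_div_mul_right _ _ h,
      mul_comm, mul_div_assoc]

lemma two_mul_sub_mul_le_sq_div {a r w y : ℝ} (hw : 0 ≤ w) (ha : w = 0 → a = 0)
    (hy : r ^ 2 ≤ y) : 2 * (a * r) - w * y ≤ a ^ 2 / w := by
  rcases hw.eq_or_lt with rfl | hw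
  · simp [ha rfl]
  · rw [le_div_iff₀ hw]
    nlinarith [sq_nonneg (a - w * r), mul_le_mul_of_nonneg_left hy (sq_nonneg w)]

lemma re_trace_mul_sum_smul_mul {n : Type*} [Fintype n] (B C : Matrix n n ℂ) (p : X → ℝ)
    (τ : X → Matrix n n ℂ) :
    (B * (∑ x, p x • τ x) * C).trace.re = ∑ x, p x * (B * τ x * C).trace.re := by
  simp only [Finset.mul_sum, Finset.sum_mul, mul_smul_comm, smul_mul_assoc, trace_sum, trace_smul,
    Complex.re_sum, Complex.smul_re, smul_eq_mul]

variable {n : Type*} [Fintype n] [DecidableEq n] {p₀ p₁ : X → ℝ} {σ₀ σ₁ : Matrix n n ℂ}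

lemma ExistsCPTP.re_trace_mul_le_invDivergence [DecidableEq X] (h : ExistsCPTP p₀ p₁ σ₀ σ₁)
    (hp₀ : 0 ≤ p₀) (hp₁ : 0 ≤ p₁) {t : ℝ} (ht : 0 < t) {S : Matrix n n ℂ}
    (hS : (σ₀ + t • σ₁) * S = σ₁) : (σ₁ * S).trace.re ≤ invDivergence t p₀ p₁ := by
  obtain ⟨τ, hτ, h₀, h₁⟩ := existsCPTP_iff_exists_mixture.mp h
  have hlin : (σ₁ * S).trace.re = ∑ x, p₁ x * (τ x * S).trace.re := by
    simpa only [h₁, one_mul] using re_trace_mul_sum_smul_mul 1 S p₁ τ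
  have hquad : (σ₁ * S).trace.re = ∑ x, (p₀ x + t * p₁ x) * (Sᴴ * τ x * S).trace.re := by
    have hmix : ∑ x, (p₀ x + t * p₁ x) • τ x = σ₀ + t • σ₁ := by
      simp only [add_smul, mul_smul, Finset.sum_add_distrib, ← Finset.smul_sum, h₀, h₁]
    have hSσ₁ : (Sᴴ * σ₁).trace.re = ∑ x, p₁ x * (Sᴴ * τ x).trace.re := by
      simpa only [h₁, mul_one] using re_trace_mul_sum_smul_mul Sᴴ 1 p₁ τ
    rw [← re_trace_mul_sum_smul_mul, hmix, mul_assoc, hS, hSσ₁, hlin]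
    simp only [re_trace_conjTranspose_mul (hτ _).1.1]
  calc (σ₁ * S).trace.re
      = ∑ x, (2 * (p₁ x * (τ x * S).trace.re) -
          (p₀ x + t * p₁ x) * (Sᴴ * τ x * S).trace.re) := by
        rw [Finset.sum_sub_distrib, ← Finset.mul_sum, ← hlin, ← hquad]
        ring
    _ ≤ invDivergence t p₀ p₁ := Finset.sum_le_sum fun x _ => by
      have htp₁ : 0 ≤ t * p₁ x := mul_nonneg ht.le (hp₁ x)
      refine two_mul_sub_mul_le_sq_div (add_nonneg (hp₀ x) htp₁) (fun hw => ?_)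
        ((hτ x).sq_re_trace_mul_le S)
      have : t * p₁ x = 0 := ((add_eq_zero_iff_of_nonneg (hp₀ x) htp₁).mp hw).2
      exact (mul_eq_zero.mp this).resolve_left ht.ne'

lemma exists_invDivergence_minimal_reverseTest (hσ₀ : IsDensityMatrix σ₀)
    (hσ₁ : IsDensityMatrix σ₁) :
    ∃ q₀ ∈ stdSimplex ℝ n, ∃ q₁ ∈ stdSimplex ℝ n, ExistsCPTP q₀ q₁ σ₀ σ₁ ∧
      ∀ {Y : Type*} [Fintype Y] [DecidableEq Y] {p₀ p₁ : Y → ℝ}, 0 ≤ p₀ → 0 ≤ p₁ →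
        ExistsCPTP p₀ p₁ σ₀ σ₁ → ∀ t > 0, invDivergence t q₀ q₁ ≤ invDivergence t p₀ p₁ := by
  obtain ⟨V, W, c, hc, h₀, h₁, hVW⟩ := exists_simultaneous_diagonalization
    (nonneg_iff_posSemidef.mpr hσ₀.1) (nonneg_iff_posSemidef.mpr hσ₁.1)
  obtain ⟨w, τ, hw, hτ, hmix⟩ := hσ₀.exists_mixture_diagonalCongruence V
  have htrace (d : n → ℝ) : (diagonalCongruence V d).trace = (∑ j, d j * w j : ℝ) := by
    rw [← hmix, trace_sum_smul_of_isDensityMatrix hτ]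
  have hmem {d : n → ℝ} (hd : 0 ≤ d) (hV : IsDensityMatrix (diagonalCongruence V d)) :
      d * w ∈ stdSimplex ℝ n :=
    ⟨mul_nonneg hd hw, by exact_mod_cast (htrace d).symm.trans hV.2⟩
  refine ⟨(1 - c) * w, hmem (fun j => sub_nonneg.mpr (hc j).2) (h₀ ▸ hσ₀),
    c * w, hmem (fun j => (hc j).1) (h₁ ▸ hσ₁),
    existsCPTP_iff_exists_mixture.mpr ⟨τ, hτ, (hmix _).trans h₀, (hmix _).trans h₁⟩, ?_⟩
  intro Y _ _ p₀ p₁ hp₀ hp₁ hp t ht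
  let k : n → ℝ := 1 - c + t • c
  have hk (j : n) : k j ≠ 0 := by
    obtain ⟨hc₀, hc₁⟩ := hc j
    refine ne_of_gt ?_
    rcases hc₀.eq_or_lt with hcj | hcj
    · simp [k, ← hcj]
    · exact add_pos_of_nonneg_of_pos (sub_nonneg.mpr hc₁) (mul_pos ht hcj)
  obtain ⟨S, hS⟩ := exists_forall_diagonalCongruence_mul hVW k⁻¹
  have hSopt : (σ₀ + t • σ₁) * S = σ₁ := by
    rw [← h₀, ← h₁, ← map_smul, ← map_add, hS]
    congr 1
    ext j
    exact mul_div_cancel₀ (c j) (hk j)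
  calc invDivergence t ((1 - c) * w) (c * w) = (σ₁ * S).trace.re := by
        rw [invDivergence_mul, ← h₁, hS, htrace, Complex.ofReal_re]
        refine Finset.sum_congr rfl fun j _ => ?_
        simp only [k, Pi.mul_apply, Pi.inv_apply, Pi.add_apply, Pi.sub_apply, Pi.one_apply,
          Pi.smul_apply, smul_eq_mul]
        ring
    _ ≤ invDivergence t p₀ p₁ := hp.re_trace_mul_le_invDivergence hp₀ hp₁ ht hSopt

end InvDivergence

section Divergence

lemma coe_finsetSum_ereal {ι : Type*} (s : Finset ι) (g : ι → ℝ) :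
    ((∑ i ∈ s, g i : ℝ) : EReal) = ∑ i ∈ s, (g i : EReal) :=
  map_sum (⟨⟨Real.toEReal, rfl⟩, EReal.coe_add⟩ : ℝ →+ EReal) g s

lemma comp_equiv_mem_stdSimplex {X Y : Type*} [Fintype X] [Fintype Y] {p : X → ℝ}
    (hp : p ∈ stdSimplex ℝ X) (e : Y ≃ X) : p ∘ e ∈ stdSimplex ℝ Y :=
  ⟨fun y => hp.1 (e y), (e.sum_comp p).trans hp.2⟩

lemma invDivergence_comp_equiv {X Y : Type*} [Fintype X] [Fintype Y] (t : ℝ) (p₀ p₁ : X → ℝ)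
    (e : Y ≃ X) : invDivergence t (p₀ ∘ e) (p₁ ∘ e) = invDivergence t p₀ p₁ :=
  e.sum_comp fun x => p₁ x ^ 2 / (p₀ x + t * p₁ x)

lemma invShift_of_add_pos {t x : ℝ} (h : 0 < t + x) : invShift t x = ((t + x)⁻¹ : ℝ) :=
  if_neg h.ne'

lemma slopeAtTop_invShift (t : ℝ) : slopeAtTop (invShift t) = 0 := by
  have hlim : Filter.Tendsto (fun x : ℝ => (t + x)⁻¹ / x) Filter.atTop (nhds 0) := by
    simpa only [mul_zero, div_eq_mul_inv, id, Pi.inv_apply] using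
      (Filter.tendsto_atTop_add_const_left _ t Filter.tendsto_id).inv_tendsto_atTop.mul
        tendsto_inv_atTop_zero
  refine (((continuous_coe_real_ereal.tendsto 0).comp hlim).congr' ?_).limsup_eq
  filter_upwards [Filter.eventually_gt_atTop (-t)] with x hx
  rw [Function.comp_apply, EReal.coe_div, invShift_of_add_pos (neg_lt_iff_pos_add'.mp hx)]

lemma fDivergence_invShift {X : Type*} [Fintype X] {t : ℝ} (ht : 0 < t) {p₀ p₁ : X → ℝ}
    (hp₀ : 0 ≤ p₀) (hp₁ : 0 ≤ p₁) :
    fDivergence (invShift t) p₀ p₁ = (invDivergence t p₀ p₁ : EReal) := by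
  have hterm (x : X) (hx : p₁ x ≠ 0) : (p₁ x : EReal) * invShift t (p₀ x / p₁ x) =
      ((p₁ x ^ 2 / (p₀ x + t * p₁ x) : ℝ) : EReal) := by
    rw [invShift_of_add_pos (add_pos_of_pos_of_nonneg ht (div_nonneg (hp₀ x) (hp₁ x))),
      ← EReal.coe_mul, add_comm t, div_add' _ _ _ hx, inv_div, pow_two, mul_div_assoc]
  rw [fDivergence, slopeAtTop_invShift, mul_zero, add_zero,
    Finset.sum_congr rfl fun x hx => hterm x (Finset.mem_filter.mp hx).2, ← coe_finsetSum_ereal,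
    invDivergence, Finset.sum_filter_of_ne]
  rintro x - hne hx
  exact hne (by rw [hx, zero_pow two_ne_zero, zero_div])

lemma slopeAtTop_congr {f g : ℝ → EReal} (hfg : f =ᶠ[Filter.atTop] g) :
    slopeAtTop f = slopeAtTop g :=
  Filter.limsup_congr (hfg.mono fun x hx => by rw [hx])

lemma fDivergence_congr {X : Type*} [Fintype X] {f g : ℝ → EReal}
    (hfg : Set.EqOn f g (Set.Ici 0)) {p₀ p₁ : X → ℝ} (hp₀ : 0 ≤ p₀) (hp₁ : 0 ≤ p₁) :
    fDivergence f p₀ p₁ = fDivergence g p₀ p₁ := by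
  have hval (x : X) : f (p₀ x / p₁ x) = g (p₀ x / p₁ x) := hfg (div_nonneg (hp₀ x) (hp₁ x))
  have hslope := slopeAtTop_congr ((Filter.eventually_ge_atTop 0).mono fun x hx => hfg hx)
  simp only [fDivergence, hval, hslope]

variable {n : Type*} [Fintype n] [DecidableEq n] {σ₀ σ₁ : Matrix n n ℂ}

lemma maxFDivergence_congr {f g : ℝ → EReal} (hfg : Set.EqOn f g (Set.Ici 0)) :
    maxFDivergence f σ₀ σ₁ = maxFDivergence g σ₀ σ₁ := by
  refine congrArg sInf (Set.ext fun d => ?_)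
  refine exists_congr fun k => exists_congr fun q₀ => exists_congr fun q₁ => ?_
  refine and_congr_right fun hq₀ => and_congr_right fun hq₁ => and_congr_right fun _ => ?_
  rw [fDivergence_congr hfg hq₀.1 hq₁.1]

lemma exists_reverseTest_maxFDivergence_invShift (hσ₀ : IsDensityMatrix σ₀)
    (hσ₁ : IsDensityMatrix σ₁) :
    ∃ q₀ ∈ stdSimplex ℝ n, ∃ q₁ ∈ stdSimplex ℝ n, ExistsCPTP q₀ q₁ σ₀ σ₁ ∧
      ∀ t > 0, maxFDivergence (invShift t) σ₀ σ₁ = (invDivergence t q₀ q₁ : EReal) := by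
  obtain ⟨q₀, hq₀, q₁, hq₁, hq, hmin⟩ := exists_invDivergence_minimal_reverseTest hσ₀ hσ₁
  refine ⟨q₀, hq₀, q₁, hq₁, hq, fun t ht => IsLeast.csInf_eq ⟨?_, ?_⟩⟩
  · let e := (Fintype.equivFin n).symm
    have hqe₀ := comp_equiv_mem_stdSimplex hq₀ e
    have hqe₁ := comp_equiv_mem_stdSimplex hq₁ e
    refine ⟨_, q₀ ∘ e, q₁ ∘ e, hqe₀, hqe₁, hq.comp_equiv e, ?_⟩
    rw [fDivergence_invShift ht hqe₀.1 hqe₁.1, invDivergence_comp_equiv]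
  · rintro _ ⟨k, r₀, r₁, hr₀, hr₁, hr, rfl⟩
    rw [fDivergence_invShift ht hr₀.1 hr₁.1, EReal.coe_le_coe_iff]
    exact hmin hr₀.1 hr₁.1 hr t ht

end Divergence

section Likelihood

lemma linearIndependent_inv_add {K : Type*} [Field K] {T : Set K} (hT : T.Infinite) :
    LinearIndependent K fun (y : K) (t : T) => ((t : K) + y)⁻¹ := by
  classical
  refine linearIndependent_iff'.mpr fun s g hg y hy => ?_
  -- Clear denominators: the numerator has infinitely many roots, and only its `y`-th term
  -- survives at the pole `-y`.
  let P : Polynomial K := ∑ z ∈ s, .C (g z) * ∏ u ∈ s.erase z, (.X + .C u)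
  have heval (t : K) : P.eval t = ∑ z ∈ s, g z * ∏ u ∈ s.erase z, (t + u) := by
    simp only [P, Polynomial.eval_finsetSum, Polynomial.eval_mul, Polynomial.eval_C,
      Polynomial.eval_prod, Polynomial.eval_add, Polynomial.eval_X]
  have hroot : T \ s.image Neg.neg ⊆ {t | P.IsRoot t} := by
    rintro t ⟨htT, hts⟩
    have hne {z : K} (hz : z ∈ s) : t + z ≠ 0 := fun h =>
      hts (Finset.mem_coe.mpr (Finset.mem_image.mpr ⟨z, hz, (eq_neg_of_add_eq_zero_left h).symm⟩))
    have hsum : ∑ z ∈ s, g z * (t + z)⁻¹ = 0 := by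
      simpa only [Finset.sum_apply, Pi.smul_apply, smul_eq_mul, Pi.zero_apply] using
        congrFun hg ⟨t, htT⟩
    calc P.eval t = (∏ u ∈ s, (t + u)) * ∑ z ∈ s, g z * (t + z)⁻¹ := by
          rw [heval, Finset.mul_sum]
          refine Finset.sum_congr rfl fun z hz => ?_
          rw [← Finset.mul_prod_erase s _ hz, mul_left_comm, mul_right_comm,
            mul_inv_cancel₀ (hne hz), one_mul]
      _ = 0 := by rw [hsum, mul_zero]
  have hP : P = 0 :=
    P.eq_zero_of_infinite_isRoot ((hT.sdiff (Finset.finite_toSet _)).mono hroot)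
  have hy_eval : P.eval (-y) = g y * ∏ u ∈ s.erase y, (-y + u) := by
    rw [heval]
    refine Finset.sum_eq_single_of_mem y hy fun z _ hzy => ?_
    rw [Finset.prod_eq_zero (Finset.mem_erase.mpr ⟨hzy.symm, hy⟩) (neg_add_cancel y), mul_zero]
  rw [hP, Polynomial.eval_zero, zero_eq_mul] at hy_eval
  refine hy_eval.resolve_right (Finset.prod_ne_zero_iff.mpr fun u hu h => ?_)
  exact Finset.ne_of_mem_erase hu (neg_add_eq_zero.mp h).symm

lemma sq_div_one_sub_add_mul (t c : ℝ) :
    c ^ 2 / (1 - c + t * c) = c * (t + (c⁻¹ - 1))⁻¹ := by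
  rcases eq_or_ne c 0 with rfl | hc
  · simp only [zero_pow two_ne_zero, zero_div, zero_mul]
  · have h : 1 - c + t * c = c * (t + (c⁻¹ - 1)) := by
      rw [mul_add, mul_sub, mul_inv_cancel₀ hc]
      ring
    rw [h, pow_two, mul_div_mul_left _ _ hc, div_eq_mul_inv]

-- The first component detects the mass at `c = 0`, where the simple fraction vanishes.
lemma linearIndependent_one_sq_div {T : Set ℝ} (hT : T.Infinite) :
    LinearIndependent ℝ fun c : ℝ =>
      ((1 : ℝ), fun t : T => c ^ 2 / (1 - c + (t : ℝ) * c)) := by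
  refine linearIndependent_iff'.mpr fun s g hg => ?_
  obtain ⟨hmass, hfrac⟩ := Prod.ext_iff.mp hg
  have hne {c : ℝ} (hc : c ∈ s) : c ≠ 0 → g c = 0 := by
    have hinj : Function.Injective fun c : ℝ => c⁻¹ - 1 :=
      sub_left_injective.comp inv_injective
    have hsum : ∑ c ∈ s, (g c * c) • (fun t : T => ((t : ℝ) + (c⁻¹ - 1))⁻¹) = 0 := by
      rw [Prod.snd_sum] at hfrac
      refine Eq.trans (Finset.sum_congr rfl fun c _ => ?_) hfrac
      ext t
      simp only [Prod.smul_snd, Pi.smul_apply, smul_eq_mul, sq_div_one_sub_add_mul, mul_assoc]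
    have := linearIndependent_iff'.mp ((linearIndependent_inv_add hT).comp _ hinj) s
      (fun c => g c * c) hsum c hc
    exact fun hc => (mul_eq_zero.mp this).resolve_right hc
  intro c hc
  rcases eq_or_ne c 0 with rfl | hc₀
  · rw [Prod.fst_sum, Finset.sum_eq_single_of_mem 0 hc
      fun b hb hb₀ => by rw [hne hb hb₀, zero_smul, Prod.fst_zero]] at hmass
    simpa using hmass
  · exact hne hc hc₀

variable {X Y : Type*}

/-- The likelihood `p₁ / (p₀ + p₁)` of the hypothesis `θ = 1` at each sample point. It is `0` by
the convention `x / 0 = 0` where both densities vanish. -/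
noncomputable def likelihood (p₀ p₁ : X → ℝ) : X → ℝ :=
  p₁ / (p₀ + p₁)

lemma likelihood_mul {p₀ p₁ : X → ℝ} (hp₀ : 0 ≤ p₀) (hp₁ : 0 ≤ p₁) :
    likelihood p₀ p₁ * (p₀ + p₁) = p₁ := by
  ext x
  refine div_mul_cancel_of_imp fun h => ?_
  exact ((add_eq_zero_iff_of_nonneg (hp₀ x) (hp₁ x)).mp h).2

lemma one_sub_likelihood_mul {p₀ p₁ : X → ℝ} (hp₀ : 0 ≤ p₀) (hp₁ : 0 ≤ p₁) :
    (1 - likelihood p₀ p₁) * (p₀ + p₁) = p₀ := by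
  rw [sub_mul, likelihood_mul hp₀ hp₁, one_mul, add_sub_cancel_right]

variable [Fintype X] [Fintype Y]

/-- The distribution of the likelihood under the measure `p₀ + p₁`, as a finitely supported
family of masses. -/
noncomputable def likelihoodLaw (p₀ p₁ : X → ℝ) : ℝ →₀ ℝ :=
  ∑ x, Finsupp.single (likelihood p₀ p₁ x) (p₀ x + p₁ x)

lemma linearCombination_likelihoodLaw {M : Type*} [AddCommMonoid M] [Module ℝ M] (v : ℝ → M)
    (p₀ p₁ : X → ℝ) : Finsupp.linearCombination ℝ v (likelihoodLaw p₀ p₁) =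
      ∑ x, (p₀ x + p₁ x) • v (likelihood p₀ p₁ x) := by
  simp only [likelihoodLaw, map_sum, Finsupp.linearCombination_single]

lemma invDivergence_eq_sum_likelihood {p₀ p₁ : X → ℝ} (hp₀ : 0 ≤ p₀) (hp₁ : 0 ≤ p₁) (t : ℝ) :
    invDivergence t p₀ p₁ = ∑ x, (p₀ x + p₁ x) *
      (likelihood p₀ p₁ x ^ 2 / (1 - likelihood p₀ p₁ x + t * likelihood p₀ p₁ x)) := by
  simpa only [one_sub_likelihood_mul hp₀ hp₁, likelihood_mul hp₀ hp₁, Pi.add_apply] using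
    invDivergence_mul t (likelihood p₀ p₁) (p₀ + p₁)

lemma likelihoodLaw_eq_of_invDivergence_eq {p₀ p₁ : X → ℝ} {q₀ q₁ : Y → ℝ} (hp₀ : 0 ≤ p₀)
    (hp₁ : 0 ≤ p₁) (hq₀ : 0 ≤ q₀) (hq₁ : 0 ≤ q₁)
    (hmass : ∑ x, (p₀ x + p₁ x) = ∑ y, (q₀ y + q₁ y)) {T : Set ℝ} (hT : T.Infinite)
    (h : ∀ t ∈ T, invDivergence t p₀ p₁ = invDivergence t q₀ q₁) :
    likelihoodLaw p₀ p₁ = likelihoodLaw q₀ q₁ := by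
  refine (linearIndependent_one_sq_div hT).finsuppLinearCombination_injective ?_
  simp only [linearCombination_likelihoodLaw]
  ext t
  · simpa only [Prod.fst_sum, Prod.smul_mk, smul_eq_mul, mul_one] using hmass
  · simpa only [Prod.snd_sum, Prod.smul_mk, Finset.sum_apply, Pi.smul_apply, smul_eq_mul,
      ← invDivergence_eq_sum_likelihood hp₀ hp₁, ← invDivergence_eq_sum_likelihood hq₀ hq₁]
      using h t t.2

variable {n : Type*} [Fintype n]

lemma exists_mixture_eq_of_statistic {ι : Type*} {ρ : Matrix n n ℂ} (hρ : IsDensityMatrix ρ)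
    (l : X → ι) {w : X → ℝ} (hw : 0 ≤ w) {τ : X → Matrix n n ℂ}
    (hτ : ∀ x, IsDensityMatrix (τ x)) :
    ∃ τ' : ι → Matrix n n ℂ, (∀ c, IsDensityMatrix (τ' c)) ∧
      ∀ g : ι → ℝ, ∑ x, w x • g (l x) • τ' (l x) = ∑ x, w x • g (l x) • τ x := by
  classical
  -- `τ' c` is the conditional expectation of `τ` given `l = c`.
  have hpos (c : ι) : (∑ x with l x = c, w x • τ x).PosSemidef :=
    posSemidef_sum _ fun x _ => (hτ x).1.smul (hw x)
  choose τ' hτ' hcond using fun c => hρ.exists_trace_smul_eq (hpos c)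
  refine ⟨τ', hτ', fun g => ?_⟩
  have hfiber (τ : X → Matrix n n ℂ) : ∑ x, w x • g (l x) • τ x =
      ∑ c ∈ Finset.univ.image l, g c • ∑ x with l x = c, w x • τ x := by
    rw [← Finset.sum_fiberwise_of_maps_to fun x _ =>
      Finset.mem_image_of_mem l (Finset.mem_univ x)]
    refine Finset.sum_congr rfl fun c _ => ?_
    rw [Finset.smul_sum]
    refine Finset.sum_congr rfl fun x hx => ?_
    rw [(Finset.mem_filter.mp hx).2, smul_comm]
  rw [hfiber, hfiber]
  refine Finset.sum_congr rfl fun c _ => congrArg (g c • ·) ?_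
  calc ∑ x with l x = c, w x • τ' (l x)
      = (∑ x with l x = c, w x) • τ' c := by
        rw [Finset.sum_smul]
        exact Finset.sum_congr rfl fun x hx => by rw [(Finset.mem_filter.mp hx).2]
    _ = ∑ x with l x = c, w x • τ x := by
        rw [← hcond c]
        simp only [trace_sum, trace_smul, (hτ _).2, Complex.re_sum, Complex.smul_re,
          Complex.one_re, smul_eq_mul, mul_one]

variable [DecidableEq X] [DecidableEq Y] [DecidableEq n] {σ₀ σ₁ : Matrix n n ℂ}

lemma existsCPTP_iff_exists_likelihood_mixture {p₀ p₁ : X → ℝ} (hσ₀ : IsDensityMatrix σ₀)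
    (hp₀ : 0 ≤ p₀) (hp₁ : 0 ≤ p₁) :
    ExistsCPTP p₀ p₁ σ₀ σ₁ ↔ ∃ τ : ℝ → Matrix n n ℂ, (∀ c, IsDensityMatrix (τ c)) ∧
      Finsupp.linearCombination ℝ (fun c => (1 - c) • τ c) (likelihoodLaw p₀ p₁) = σ₀ ∧
      Finsupp.linearCombination ℝ (fun c => c • τ c) (likelihoodLaw p₀ p₁) = σ₁ := by
  have h₀ (τ : X → Matrix n n ℂ) : ∑ x, (p₀ x + p₁ x) • (1 - likelihood p₀ p₁ x) • τ x =
      ∑ x, p₀ x • τ x := Finset.sum_congr rfl fun x _ => by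
    rw [smul_smul, mul_comm]
    exact congrArg (· • τ x) (congrFun (one_sub_likelihood_mul hp₀ hp₁) x)
  have h₁ (τ : X → Matrix n n ℂ) : ∑ x, (p₀ x + p₁ x) • likelihood p₀ p₁ x • τ x =
      ∑ x, p₁ x • τ x := Finset.sum_congr rfl fun x _ => by
    rw [smul_smul, mul_comm]
    exact congrArg (· • τ x) (congrFun (likelihood_mul hp₀ hp₁) x)
  simp only [linearCombination_likelihoodLaw, existsCPTP_iff_exists_mixture]
  constructor
  · rintro ⟨τ, hτ, rfl, rfl⟩
    obtain ⟨τ', hτ', hmix⟩ := exists_mixture_eq_of_statistic hσ₀ (likelihood p₀ p₁)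
      (add_nonneg hp₀ hp₁) hτ
    exact ⟨τ', hτ', (hmix fun c => 1 - c).trans (h₀ τ), (hmix id).trans (h₁ τ)⟩
  · rintro ⟨τ, hτ, rfl, rfl⟩
    exact ⟨τ ∘ likelihood p₀ p₁, fun x => hτ _, (h₀ _).symm, (h₁ _).symm⟩

lemma ExistsCPTP.of_likelihoodLaw_eq {p₀ p₁ : X → ℝ} {q₀ q₁ : Y → ℝ} (hσ₀ : IsDensityMatrix σ₀)
    (hq : ExistsCPTP q₀ q₁ σ₀ σ₁) (hp₀ : 0 ≤ p₀) (hp₁ : 0 ≤ p₁) (hq₀ : 0 ≤ q₀) (hq₁ : 0 ≤ q₁)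
    (h : likelihoodLaw p₀ p₁ = likelihoodLaw q₀ q₁) : ExistsCPTP p₀ p₁ σ₀ σ₁ := by
  rw [existsCPTP_iff_exists_likelihood_mixture hσ₀ hp₀ hp₁, h]
  exact (existsCPTP_iff_exists_likelihood_mixture hσ₀ hq₀ hq₁).mp hq

end Likelihood

section OperatorConvexity

lemma operatorConvex_inv_add {t : ℝ} (ht : 0 < t) : OperatorConvex fun x => (t + x)⁻¹ := by
  intro m
  refine (CStarAlgebra.convexOn_ringInverse_algebraMap_add ht).congr fun A hA => ?_
  have hA' : 0 ≤ A := hA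
  have hsa : IsSelfAdjoint A := hA'.isSelfAdjoint
  rw [cfc_inv (fun x : ℝ => t + x) A fun x hx =>
    (add_pos_of_pos_of_nonneg ht (spectrum_nonneg_of_nonneg hA' hx)).ne',
    cfc_const_add t (fun x => x) A, cfc_id' ℝ A]

lemma fDivergence_invShift_eq_maxFDivergence_of_operatorConvex {X n : Type*} [Fintype X]
    [Fintype n] [DecidableEq n] {p₀ p₁ : X → ℝ} (hp₀ : 0 ≤ p₀) (hp₁ : 0 ≤ p₁) {σ₀ σ₁ : Matrix n n ℂ}
    (h : ∀ f : ℝ → ℝ, ContinuousOn f (Set.Ici 0) → OperatorConvex f →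
      fDivergence (fun x => (f x : EReal)) p₀ p₁ = maxFDivergence (fun x => (f x : EReal)) σ₀ σ₁)
    {t : ℝ} (ht : 0 < t) :
    fDivergence (invShift t) p₀ p₁ = maxFDivergence (invShift t) σ₀ σ₁ := by
  have hpos (x : ℝ) (hx : x ∈ Set.Ici 0) : 0 < t + x := add_pos_of_pos_of_nonneg ht hx
  have hcont : ContinuousOn (fun x : ℝ => (t + x)⁻¹) (Set.Ici 0) :=
    (by fun_prop : ContinuousOn (fun x : ℝ => t + x) (Set.Ici 0)).inv₀ fun x hx => (hpos x hx).ne'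
  have hf : Set.EqOn (invShift t) (fun x => ((t + x)⁻¹ : ℝ)) (Set.Ici 0) := fun x hx =>
    invShift_of_add_pos (hpos x hx)
  rw [fDivergence_congr hf hp₀ hp₁, maxFDivergence_congr hf]
  exact h _ hcont (operatorConvex_inv_add ht)

end OperatorConvexity

theorem mainTheorem2_general {X n : Type*} [Fintype X] [DecidableEq X] [Fintype n] [DecidableEq n]
    (p₀ p₁ : X → ℝ) (hp₀ : p₀ ∈ stdSimplex ℝ X) (hp₁ : p₁ ∈ stdSimplex ℝ X)
    (σ₀ σ₁ : Matrix n n ℂ) (hσ₀ : IsDensityMatrix σ₀) (hσ₁ : IsDensityMatrix σ₁)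
    {T : Set ℝ} (hT : T.Infinite) (hT₀ : T ⊆ Set.Ioi 0)
    (h : ∀ t ∈ T, fDivergence (invShift t) p₀ p₁ = maxFDivergence (invShift t) σ₀ σ₁) :
    ExistsCPTP p₀ p₁ σ₀ σ₁ := by
  obtain ⟨q₀, hq₀, q₁, hq₁, hq, hmax⟩ := exists_reverseTest_maxFDivergence_invShift hσ₀ hσ₁
  have hdiv (t : ℝ) (ht : t ∈ T) : invDivergence t p₀ p₁ = invDivergence t q₀ q₁ := by
    have := h t ht
    rwa [hmax t (hT₀ ht), fDivergence_invShift (hT₀ ht) hp₀.1 hp₁.1,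
      EReal.coe_eq_coe_iff] at this
  have hmass : ∑ x, (p₀ x + p₁ x) = ∑ j, (q₀ j + q₁ j) := by
    simp only [Finset.sum_add_distrib, hp₀.2, hp₁.2, hq₀.2, hq₁.2]
  exact hq.of_likelihoodLaw_eq hσ₀ hp₀.1 hp₁.1 hq₀.1 hq₁.1
    (likelihoodLaw_eq_of_invDivergence_eq hp₀.1 hp₁.1 hq₀.1 hq₁.1 hmass hT hdiv)

theorem mainTheorem2 {X n : Type*} [Fintype X] [DecidableEq X] [Fintype n] [DecidableEq n]
    (p₀ p₁ : X → ℝ) (hp₀ : p₀ ∈ stdSimplex ℝ X) (hp₁ : p₁ ∈ stdSimplex ℝ X)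
    (σ₀ σ₁ : Matrix n n ℂ) (hσ₀ : IsDensityMatrix σ₀) (hσ₁ : IsDensityMatrix σ₁) :
    ((∀ f : ℝ → ℝ, ContinuousOn f (Set.Ici 0) → OperatorConvex f →
        fDivergence (fun x => (f x : EReal)) p₀ p₁ =
          maxFDivergence (fun x => (f x : EReal)) σ₀ σ₁) →
      ExistsCPTP p₀ p₁ σ₀ σ₁) ∧
    (∀ s₀ : ℝ, 0 < s₀ → s₀ < 1 →
      (∀ t : ℝ, 0 ≤ t →
        fDivergence (invShift t) p₀ p₁ = maxFDivergence (invShift t) σ₀ σ₁) →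
      (∀ s : ℝ, s₀ < s → s < 1 →
        fDivergence (negPow s) p₀ p₁ = maxFDivergence (negPow s) σ₀ σ₁) →
      ExistsCPTP p₀ p₁ σ₀ σ₁) := by
  have hmain := mainTheorem2_general p₀ p₁ hp₀ hp₁ σ₀ σ₁ hσ₀ hσ₁ (Set.Ioi_infinite 0) subset_rfl
  exact ⟨fun h => hmain fun _ ht =>
      fDivergence_invShift_eq_maxFDivergence_of_operatorConvex hp₀.1 hp₁.1 h ht,
    fun _ _ _ h _ => hmain fun t ht => h t (Set.mem_Ioi.mp ht).le⟩
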